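/- Let $-\infty\le f_{\min}<0$ and let $f:\,]-1,+\infty[\,\to\,]f_{\min},+\infty[$ be a surjective $C^2$ function with $\lim_{y\to-1^+}f(y)=+\infty$, $f(0)=0$, $f'(0)=-1$ and $f'(y)<0<f''(y)$ for all $y>-1$; let $f^{-1}:\,]f_{\min},+\infty[\,\to\,]-1,+\infty[$ be its inverse. Let $\omega>0$ and $T=2\pi/\omega$. For every $A\ge 0$ the equation $$y'(t)=f(y(t))+A\sin(\omega t)$$ has a unique $T$-periodic solution $Y(\cdot,A):\mathbb R\to\,]-1,+\infty[$. Its initial value $Y_0(A)=Y(0,A)$ is a strictly decreasing and strictly convex function of $A\in[0,+\infty[$. For every $A\ge0$, $$-1<\max\left(f^{-1}(A),\,-\frac{A\,\omega}{1+\omega^2}\right)\le Y_0(A)\le 0,$$ and $Y_0(A)=0$ if and only if $A=0$. Moreover, as $A\to0^+$, $$Y_0(A)=-\frac{A\,\omega}{1+\omega^2}+\mathcal O(A^2).$$ -/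

import Mathlib

open Set Filter Topology Asymptotics

/-- The standing assumptions on the nonlinearity `f : ]-1, +∞[ → ]fmin, +∞[` of the model ODE
`y' = f(y) + A sin(ω t)`, where `-∞ ≤ fmin < 0`. The values of `f` on `]-∞, -1]` play no role. -/
structure IsCrackLaw (f : ℝ → ℝ) (fmin : EReal) : Prop where
  contDiffOn : ContDiffOn ℝ 2 f (Ioi (-1))
  fmin_neg : fmin < 0
  image_eq : f '' Ioi (-1) = {x : ℝ | fmin < (x : EReal)}
  tendsto_atTop : Tendsto f (𝓝[>] (-1)) atTop
  map_zero : f 0 = 0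
  deriv_zero : deriv f 0 = -1
  deriv_neg : ∀ y : ℝ, -1 < y → deriv f y < 0
  deriv_deriv_pos : ∀ y : ℝ, -1 < y → 0 < deriv (deriv f) y

/-- The reciprocal function `f⁻¹ : ]fmin, +∞[ → ]-1, +∞[` of the injective map
`f : ]-1, +∞[ → ]fmin, +∞[`. -/
noncomputable def crackLawInv (f : ℝ → ℝ) : ℝ → ℝ :=
  Function.invFunOn f (Ioi (-1))

/-- `Y` is a `T`-periodic solution, with `T = 2π/ω` and values in `]-1, +∞[`, of
`y' = f(y) + A sin(ω t)`. -/
structure IsPeriodicSolution (f : ℝ → ℝ) (ω A : ℝ) (Y : ℝ → ℝ) : Prop where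
  mem_domain : ∀ t : ℝ, -1 < Y t
  hasDerivAt : ∀ t : ℝ, HasDerivAt Y (f (Y t) + A * Real.sin (ω * t)) t
  periodic : Function.Periodic Y (2 * Real.pi / ω)

/-! Almost every comparison evaluates the equation at an extremum of a periodic combination of
solutions: the derivative vanishes there, and monotonicity or convexity of `f` gives the inequality,
which then holds at all times. This yields uniqueness, the lower bounds, convexity of the initial
value and its expansion. Existence: clamp `f` to an interval that traps the solution, extend it with
slope bounded away from 0, and find the periodic solution as the fixed point of a contraction
(`exists_periodic_solution_of_strongly_decreasing`). Strict monotonicity in `A` is subtler, since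
the forcing changes sign. If the initial value failed to decrease, comparison forward on the
half-period where the sine is nonnegative and backward on the other would order the solutions
globally (`le_of_le_at_zero`); periodicity then forces them to coincide. The upper bound 0 follows,
as the solution for `A = 0` is zero. -/

open MeasureTheory BoundedContinuousFunction

/-- A differentiable periodic function has a critical point at which it is maximal. -/
theorem Function.Periodic.exists_isMax_hasDerivAt_eq_zero {W W' : ℝ → ℝ} {T : ℝ}
    (hper : Function.Periodic W T) (hT : T ≠ 0) (hW : ∀ t, HasDerivAt W (W' t) t) :
    ∃ t₀, W' t₀ = 0 ∧ ∀ t, W t ≤ W t₀ := by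
  have hc : Continuous W := continuous_iff_continuousAt.2 fun t => (hW t).continuousAt
  obtain ⟨x, ⟨t₀, rfl⟩, h⟩ :=
    (hper.compact_of_continuous hT hc).exists_isGreatest (range_nonempty W)
  have hmax : ∀ t, W t ≤ W t₀ := fun t => h (mem_range_self t)
  exact ⟨t₀, IsLocalMax.hasDerivAt_eq_zero (Eventually.of_forall hmax) (hW t₀), hmax⟩

/-- A differentiable periodic function has a critical point at which it is minimal. -/
theorem Function.Periodic.exists_isMin_hasDerivAt_eq_zero {W W' : ℝ → ℝ} {T : ℝ}
    (hper : Function.Periodic W T) (hT : T ≠ 0) (hW : ∀ t, HasDerivAt W (W' t) t) :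
    ∃ t₀, W' t₀ = 0 ∧ ∀ t, W t₀ ≤ W t := by
  obtain ⟨t₀, h0, h⟩ := Function.Periodic.exists_isMax_hasDerivAt_eq_zero
    (W := fun t => -W t) (W' := fun t => -W' t) (fun t => by simp only [hper t]) hT
    (fun t => (hW t).neg)
  exact ⟨t₀, by linarith, fun t => by linarith [h t]⟩

/-! ### Periodic solutions by contraction -/

/-- The bounded solution of `u' = -K u + g`. -/
noncomputable def expConv (K : ℝ) (g : ℝ → ℝ) (t : ℝ) : ℝ :=
  Real.exp (-(K * t)) * ∫ s in Iic t, Real.exp (K * s) * g s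

theorem integrableOn_exp_mul_bcf {K : ℝ} (hK : 0 < K) (g : ℝ →ᵇ ℝ) (t : ℝ) :
    IntegrableOn (fun s => Real.exp (K * s) * g s) (Iic t) := by
  refine Integrable.mono' ((integrableOn_exp_mul_Iic hK t).mul_const ‖g‖)
    (by fun_prop) (Eventually.of_forall fun s => ?_)
  rw [norm_mul, Real.norm_eq_abs, Real.abs_exp]
  exact mul_le_mul_of_nonneg_left (g.norm_coe_le_norm s) (Real.exp_pos _).le

theorem abs_expConv_le {K : ℝ} (hK : 0 < K) (g : ℝ →ᵇ ℝ) (t : ℝ) :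
    |expConv K g t| ≤ ‖g‖ / K := by
  have h : ‖∫ s in Iic t, Real.exp (K * s) * g s‖ ≤ ∫ s in Iic t, Real.exp (K * s) * ‖g‖ := by
    refine norm_integral_le_of_norm_le ((integrableOn_exp_mul_Iic hK t).mul_const ‖g‖)
      (Eventually.of_forall fun s => ?_)
    rw [norm_mul, Real.norm_eq_abs, Real.abs_exp]
    exact mul_le_mul_of_nonneg_left (g.norm_coe_le_norm s) (Real.exp_pos _).le
  rw [integral_mul_const, integral_exp_mul_Iic hK] at h
  rw [expConv, abs_mul, Real.abs_exp]
  calc Real.exp (-(K * t)) * |∫ s in Iic t, Real.exp (K * s) * g s|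
      ≤ Real.exp (-(K * t)) * (Real.exp (K * t) / K * ‖g‖) :=
        mul_le_mul_of_nonneg_left h (Real.exp_pos _).le
    _ = (Real.exp (-(K * t)) * Real.exp (K * t)) * (‖g‖ / K) := by ring
    _ = ‖g‖ / K := by rw [← Real.exp_add, neg_add_cancel, Real.exp_zero, one_mul]

theorem expConv_sub {K : ℝ} (hK : 0 < K) (g₁ g₂ : ℝ →ᵇ ℝ) (t : ℝ) :
    expConv K g₁ t - expConv K g₂ t = expConv K (g₁ - g₂ : ℝ →ᵇ ℝ) t := by
  simp only [expConv]
  rw [← mul_sub, ← integral_sub (integrableOn_exp_mul_bcf hK g₁ t)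
    (integrableOn_exp_mul_bcf hK g₂ t)]
  simp only [BoundedContinuousFunction.coe_sub, Pi.sub_apply, mul_sub]

theorem hasDerivAt_expConv {K : ℝ} (hK : 0 < K) (g : ℝ →ᵇ ℝ) (t : ℝ) :
    HasDerivAt (expConv K g) (-(K * expConv K g t) + g t) t := by
  have hc : Continuous fun s => Real.exp (K * s) * g s := by fun_prop
  have h1 : HasDerivAt (fun u => ∫ s in Iic u, Real.exp (K * s) * g s)
      (Real.exp (K * t) * g t) t := by
    have h2 := (intervalIntegral.integral_hasDerivAt_right
      (hc.intervalIntegrable 0 t) (hc.stronglyMeasurableAtFilter _ _) hc.continuousAt).add_const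
      (∫ s in Iic (0 : ℝ), Real.exp (K * s) * g s)
    refine h2.congr_of_eventuallyEq (Eventually.of_forall fun u => ?_)
    simp only
    rw [← intervalIntegral.integral_Iic_sub_Iic (integrableOn_exp_mul_bcf hK g 0)
      (integrableOn_exp_mul_bcf hK g u), sub_add_cancel]
  have h3 : HasDerivAt (fun u : ℝ => Real.exp (-(K * u))) (Real.exp (-(K * t)) * (-(K * 1))) t :=
    (((hasDerivAt_id t).const_mul K).neg).exp
  refine (h3.mul h1).congr_deriv ?_
  have h4 : Real.exp (-(K * t)) * Real.exp (K * t) = 1 := by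
    rw [← Real.exp_add, neg_add_cancel, Real.exp_zero]
  simp only [expConv]
  linear_combination g t * h4

/-- Commuting with time shifts is what makes the fixed point inherit the period of the forcing. -/
theorem expConv_add (K : ℝ) (g : ℝ → ℝ) (c t : ℝ) :
    expConv K g (t + c) = expConv K (fun s => g (s + c)) t := by
  have h := (measurePreserving_add_right volume c).setIntegral_preimage_emb
    (measurableEmbedding_addRight c) (fun s => Real.exp (K * s) * g s) (Iic (t + c))
  have h2 : (fun x => x + c) ⁻¹' Iic (t + c) = Iic t := by ext x; simp
  rw [h2] at h
  simp only [expConv]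
  rw [← h]
  have h3 : ∀ x, Real.exp (K * (x + c)) * g (x + c)
      = Real.exp (K * c) * (Real.exp (K * x) * g (x + c)) := fun x => by
    rw [mul_add, Real.exp_add]; ring
  simp only [h3]
  rw [integral_const_mul, ← mul_assoc, ← Real.exp_add]
  congr 2
  ring

/-- The equation `y' = Φ(y) + g(t)`, with `Φ` having difference quotients in `[-K, -k]`,
has a periodic solution when `g` is periodic. -/
theorem exists_periodic_solution_of_strongly_decreasing {Φ : ℝ → ℝ} {k K T : ℝ} (hk : 0 < k)
    (hkK : k ≤ K)
    (hΦ : ∀ x y, x ≤ y → -K * (y - x) ≤ Φ y - Φ x ∧ Φ y - Φ x ≤ -k * (y - x))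
    (g : ℝ →ᵇ ℝ) (hg : Function.Periodic g T) :
    ∃ Y : ℝ → ℝ, (∀ t, HasDerivAt Y (Φ (Y t) + g t) t) ∧ Function.Periodic Y T := by
  have hK : 0 < K := hk.trans_le hkK
  -- Adding `K * x` moves the slopes from `[-K, -k]` to `[0, K - k]`; the gain `1 / K` of `expConv`
  -- then gives the ratio `(K - k) / K < 1`.
  have hlip : LipschitzWith (K - k).toNNReal fun x => Φ x + K * x := by
    refine LipschitzWith.of_dist_le_mul fun x y => ?_
    rw [Real.coe_toNNReal _ (by linarith), Real.dist_eq, Real.dist_eq]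
    rcases le_total x y with h | h
    · have := hΦ x y h
      rw [abs_sub_comm, abs_sub_comm x, abs_of_nonneg (by linarith), abs_of_nonneg (by linarith)]
      linarith
    · have := hΦ y x h
      rw [abs_of_nonneg (by linarith), abs_of_nonneg (by linarith)]
      linarith
  let F : (ℝ →ᵇ ℝ) → (ℝ →ᵇ ℝ) := fun y => y.comp _ hlip + g
  have hF : ∀ y t, F y t = Φ (y t) + K * y t + g t := fun y t => rfl
  let S : (ℝ →ᵇ ℝ) → (ℝ →ᵇ ℝ) := fun y =>
    ofNormedAddCommGroup (expConv K (F y))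
      (continuous_iff_continuousAt.2 fun t => (hasDerivAt_expConv hK _ t).continuousAt)
      (‖F y‖ / K) (fun t => abs_expConv_le hK _ t)
  have hS : ∀ y t, S y t = expConv K (F y) t := fun y t => rfl
  have hcontr : ContractingWith ((K - k) / K).toNNReal S := by
    refine ⟨?_, LipschitzWith.of_dist_le_mul fun y z => ?_⟩
    · rw [← NNReal.coe_lt_coe, Real.coe_toNNReal _ (div_nonneg (by linarith) hK.le),
        NNReal.coe_one, div_lt_one hK]
      linarith
    · rw [Real.coe_toNNReal _ (div_nonneg (by linarith) hK.le),
        BoundedContinuousFunction.dist_le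
          (mul_nonneg (div_nonneg (by linarith) hK.le) dist_nonneg)]
      intro t
      rw [hS, hS, Real.dist_eq, expConv_sub hK]
      refine (abs_expConv_le hK _ t).trans ?_
      rw [div_mul_eq_mul_div]
      refine div_le_div_of_nonneg_right ?_ hK.le
      rw [← dist_eq_norm, BoundedContinuousFunction.dist_le
          (mul_nonneg (by linarith) dist_nonneg)]
      intro s
      have h1 := hlip.dist_le_mul (y s) (z s)
      rw [Real.coe_toNNReal _ (by linarith)] at h1
      rw [hF, hF, dist_add_right]
      exact h1.trans (mul_le_mul_of_nonneg_left (BoundedContinuousFunction.dist_coe_le_dist s)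
        (by linarith))
  set Y := hcontr.fixedPoint S with hY
  have hfix : S Y = Y := hcontr.fixedPoint_isFixedPt
  have hfix' : ∀ t, expConv K (F Y) t = Y t := fun t => DFunLike.congr_fun hfix t
  refine ⟨Y, fun t => ?_, ?_⟩
  · have h := hasDerivAt_expConv hK (F Y) t
    have h2 : expConv K (F Y) = Y := funext hfix'
    rw [h2, hF] at h
    exact h.congr_deriv (by ring)
  · let Z : ℝ →ᵇ ℝ := Y.compContinuous ⟨fun t => t + T, by fun_prop⟩
    have hZ : ∀ t, Z t = Y (t + T) := fun t => rfl
    have hZfix : S Z = Z := by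
      ext t
      rw [hS, hZ, ← hfix', expConv_add]
      congr 1
      ext s
      rw [hF, hF, hZ, hg s]
    have : Z = Y := hcontr.fixedPoint_unique' hZfix hfix
    intro t
    rw [← hZ, this]

/-! ### Convexity estimates for `f` -/

namespace IsCrackLaw

variable {f : ℝ → ℝ} {fmin : EReal}

theorem hasDerivAt (hf : IsCrackLaw f fmin) {y : ℝ} (hy : -1 < y) :
    HasDerivAt f (deriv f y) y :=
  ((hf.contDiffOn.differentiableOn (by norm_num)).differentiableAt
    (isOpen_Ioi.mem_nhds hy)).hasDerivAt

theorem continuousOn (hf : IsCrackLaw f fmin) : ContinuousOn f (Ioi (-1)) :=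
  hf.contDiffOn.continuousOn

theorem strictAntiOn (hf : IsCrackLaw f fmin) : StrictAntiOn f (Ioi (-1)) :=
  strictAntiOn_of_deriv_neg (convex_Ioi _) hf.continuousOn fun y hy =>
    hf.deriv_neg y (interior_subset hy)

theorem strictConvexOn (hf : IsCrackLaw f fmin) : StrictConvexOn ℝ (Ioi (-1)) f :=
  strictConvexOn_of_deriv2_pos' (convex_Ioi _) hf.continuousOn hf.deriv_deriv_pos

theorem differentiableAt_deriv (hf : IsCrackLaw f fmin) {y : ℝ} (hy : -1 < y) :
    DifferentiableAt ℝ (deriv f) y :=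
  -- `deriv` takes the value 0 where differentiability fails.
  differentiableAt_of_deriv_ne_zero (hf.deriv_deriv_pos y hy).ne'

/-- The graph of `f` lies above its tangents. -/
theorem tangent_le (hf : IsCrackLaw f fmin) {x y : ℝ} (hx : -1 < x) (hy : -1 < y) :
    f x + deriv f x * (y - x) ≤ f y := by
  rcases lt_trichotomy x y with h | rfl | h
  · have h1 := hf.strictConvexOn.convexOn.le_slope_of_hasDerivAt hx hy h (hf.hasDerivAt hx)
    rw [slope_def_field, le_div_iff₀ (sub_pos.2 h)] at h1
    linarith
  · simp
  · have h1 := hf.strictConvexOn.convexOn.slope_le_of_hasDerivAt hy hx h (hf.hasDerivAt hx)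
    rw [slope_def_field, div_le_iff₀ (sub_pos.2 h)] at h1
    linarith

theorem neg_le (hf : IsCrackLaw f fmin) {y : ℝ} (hy : -1 < y) : -y ≤ f y := by
  have h := hf.tangent_le (x := 0) (by norm_num) hy
  rw [hf.map_zero, hf.deriv_zero] at h
  linarith

theorem deriv_le_deriv (hf : IsCrackLaw f fmin) {x y : ℝ} (hx : -1 < x) (hxy : x ≤ y) :
    deriv f x ≤ deriv f y := by
  rcases hxy.eq_or_lt with rfl | h
  · rfl
  · have h1 := hf.tangent_le hx (hx.trans h)
    have h2 := hf.tangent_le (hx.trans h) hx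
    have h3 : 0 ≤ (deriv f y - deriv f x) * (y - x) := by linarith
    exact sub_nonneg.1 (nonneg_of_mul_nonneg_left h3 (sub_pos.2 h))

/-- Near the origin, `f` is below its tangent up to a quadratic term. -/
theorem exists_le_neg_add_sq (hf : IsCrackLaw f fmin) :
    ∃ C δ : ℝ, 0 ≤ C ∧ 0 < δ ∧ δ < 1 ∧ ∀ y, |y| ≤ δ → f y ≤ -y + C * y ^ 2 := by
  have hd : (fun y => deriv f y - deriv f 0) =O[𝓝 0] fun y => y - 0 :=
    (hf.differentiableAt_deriv (y := 0) (by norm_num)).isBigO_sub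
  obtain ⟨C, hC, h⟩ := hd.exists_nonneg
  obtain ⟨δ, hδ, hball⟩ := Metric.eventually_nhds_iff.1 h.bound
  refine ⟨C, min (δ / 2) (1 / 2), hC, by positivity,
    (min_le_right _ _).trans_lt (by norm_num), fun y hy => ?_⟩
  have hy1 : |y| ≤ δ / 2 := hy.trans (min_le_left _ _)
  have hy2 : |y| ≤ 1 / 2 := hy.trans (min_le_right _ _)
  have hy3 : -1 < y := by linarith [(abs_le.1 hy2).1]
  have h1 := hball (y := y) (by rw [Real.dist_eq, sub_zero]; linarith)
  rw [hf.deriv_zero, Real.norm_eq_abs, Real.norm_eq_abs, sub_zero, sub_neg_eq_add] at h1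
  -- The tangent at `y`, evaluated at 0, gives `f y ≤ y * deriv f y`, so a first-order bound on
  -- `deriv f` suffices.
  have h2 := hf.tangent_le hy3 (y := 0) (by norm_num)
  rw [hf.map_zero] at h2
  have h3 : y * (deriv f y + 1) ≤ C * y ^ 2 := by
    calc y * (deriv f y + 1) ≤ |y * (deriv f y + 1)| := le_abs_self _
      _ = |y| * |deriv f y + 1| := abs_mul _ _
      _ ≤ |y| * (C * |y|) := mul_le_mul_of_nonneg_left h1 (abs_nonneg _)
      _ = C * y ^ 2 := by rw [← sq_abs y]; ring
  linarith

theorem crackLawInv_spec (hf : IsCrackLaw f fmin) {A : ℝ} (hA : 0 ≤ A) :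
    -1 < crackLawInv f A ∧ f (crackLawInv f A) = A ∧ crackLawInv f A ≤ 0 := by
  have hmem : A ∈ f '' Ioi (-1) := by
    rw [hf.image_eq]
    exact hf.fmin_neg.trans_le (by exact_mod_cast hA)
  have h1 : -1 < crackLawInv f A := Function.invFunOn_mem hmem
  have h2 : f (crackLawInv f A) = A := Function.invFunOn_eq hmem
  refine ⟨h1, h2, ?_⟩
  rw [← hf.strictAntiOn.le_iff_ge (a := 0) (by simp) h1, hf.map_zero, h2]
  exact hA

/-- Difference quotients of `f` on a compact interval are bounded by the slopes at its ends. -/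
theorem slope_bounds (hf : IsCrackLaw f fmin) {m M x y : ℝ} (hm : -1 < m) (hx : m ≤ x)
    (hxy : x ≤ y) (hy : y ≤ M) :
    deriv f m * (y - x) ≤ f y - f x ∧ f y - f x ≤ deriv f M * (y - x) := by
  have hx1 : -1 < x := by linarith
  have hy1 : -1 < y := by linarith
  have h1 := hf.tangent_le hx1 hy1
  have h2 := hf.tangent_le hy1 hx1
  have h3 := mul_le_mul_of_nonneg_right (hf.deriv_le_deriv hm hx) (sub_nonneg.2 hxy)
  have h4 := mul_le_mul_of_nonneg_right (hf.deriv_le_deriv hy1 hy) (sub_nonneg.2 hxy)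
  constructor <;> linarith

end IsCrackLaw

/-! ### Existence, uniqueness and lower bounds -/

section PeriodicSolution

variable {f : ℝ → ℝ} {fmin : EReal} {ω A B : ℝ}

theorem two_pi_div_ne_zero (hω : 0 < ω) : 2 * Real.pi / ω ≠ 0 := by positivity

theorem periodic_sin_mul (hω : 0 < ω) :
    Function.Periodic (fun t => Real.sin (ω * t)) (2 * Real.pi / ω) := fun t => by
  simp only [mul_add, mul_div_cancel₀ _ hω.ne', Real.sin_add_two_pi]

theorem periodic_cos_mul (hω : 0 < ω) :
    Function.Periodic (fun t => Real.cos (ω * t)) (2 * Real.pi / ω) := fun t => by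
  simp only [mul_add, mul_div_cancel₀ _ hω.ne', Real.cos_add_two_pi]

theorem hasDerivAt_cos_mul (ω t : ℝ) :
    HasDerivAt (fun t => Real.cos (ω * t)) (-(ω * Real.sin (ω * t))) t :=
  (((hasDerivAt_id t).const_mul ω).cos).congr_deriv (by simp; ring)

theorem hasDerivAt_sin_mul (ω t : ℝ) :
    HasDerivAt (fun t => Real.sin (ω * t)) (ω * Real.cos (ω * t)) t :=
  (((hasDerivAt_id t).const_mul ω).sin).congr_deriv (by simp; ring)

theorem IsCrackLaw.exists_isPeriodicSolution (hf : IsCrackLaw f fmin) (hω : 0 < ω)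
    (hA : 0 ≤ A) : ∃ Y, IsPeriodicSolution f ω A Y := by
  obtain ⟨hm1, hfm, hm0⟩ := hf.crackLawInv_spec hA
  set m := crackLawInv f A with hm
  set M := 2 * A / ω with hM
  have hM0 : 0 ≤ M := by positivity
  have hmM : m ≤ M := hm0.trans hM0
  set k := -deriv f M with hk
  have hk0 : 0 < k := by have := hf.deriv_neg M (by linarith); linarith
  set K := -deriv f m with hK
  have hkK : k ≤ K := by have := hf.deriv_le_deriv hm1 hmM; linarith
  let c : ℝ → ℝ := fun y => max m (min y M)
  have hcm : ∀ y, m ≤ c y := fun y => le_max_left _ _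
  have hcM : ∀ y, c y ≤ M := fun y => max_le hmM (min_le_right _ _)
  have hcid : ∀ y, m ≤ y → y ≤ M → c y = y := fun y h1 h2 => by
    simp only [c, min_eq_left h2, max_eq_right h1]
  have hcmono : ∀ x y, x ≤ y → c x ≤ c y ∧ c y - c x ≤ y - x := fun x y hxy => by
    simp only [c]
    grind
  -- Outside `[m, M]` the clamped `f` is continued with slope `-k`; the bounds `hlow` and `hupp`
  -- later show that the solution never leaves `[m, M]`.
  let Φ : ℝ → ℝ := fun y => f (c y) - k * (y - c y)
  have hΦ : ∀ x y, x ≤ y → -K * (y - x) ≤ Φ y - Φ x ∧ Φ y - Φ x ≤ -k * (y - x) := by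
    intro x y hxy
    obtain ⟨h1, h2⟩ := hcmono x y hxy
    obtain ⟨h3, h4⟩ := hf.slope_bounds hm1 (hcm x) h1 (hcM y)
    have h5 : 0 ≤ (K - k) * ((y - x) - (c y - c x)) :=
      mul_nonneg (by linarith) (by linarith)
    constructor
    · simp only [Φ]; linarith
    · simp only [Φ]; linarith
  have hΦid : ∀ y, m ≤ y → y ≤ M → Φ y = f y := fun y h1 h2 => by
    simp only [Φ, hcid y h1 h2, sub_self, mul_zero, sub_zero]
  have hΦanti : StrictAnti Φ := fun x y hxy => by
    have := (hΦ x y hxy.le).2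
    have := mul_pos hk0 (sub_pos.2 hxy)
    linarith
  let g : ℝ →ᵇ ℝ := ofNormedAddCommGroup (fun t => A * Real.sin (ω * t)) (by fun_prop) A
    fun t => by
      rw [norm_mul, Real.norm_of_nonneg hA]
      exact mul_le_of_le_one_right hA (Real.abs_sin_le_one _)
  have hg : ∀ t, g t = A * Real.sin (ω * t) := fun t => rfl
  obtain ⟨Y, hY, hYper⟩ := exists_periodic_solution_of_strongly_decreasing hk0 hkK hΦ g
    (T := 2 * Real.pi / ω) fun t => by
      have := periodic_sin_mul hω t
      simp only at this
      rw [hg, hg, this]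
  have hlow : ∀ t, m ≤ Y t := by
    obtain ⟨t₀, h0, hmin⟩ := hYper.exists_isMin_hasDerivAt_eq_zero (two_pi_div_ne_zero hω) hY
    have h1 : m ≤ Y t₀ := by
      rw [← hΦanti.le_iff_ge, hΦid m le_rfl hmM, hfm]
      rw [hg] at h0
      have := mul_le_mul_of_nonneg_left (Real.neg_one_le_sin (ω * t₀)) hA
      linarith
    exact fun t => h1.trans (hmin t)
  have hupp : ∀ t, Y t ≤ M := by
    -- Adding a primitive of `-A sin(ωt)` leaves the derivative `Φ (Y t)`, so `Y` vanishes where the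
    -- sum is maximal. Two cosine bounds give `M = 2A/ω`.
    have hper : Function.Periodic (fun t => Y t + A / ω * Real.cos (ω * t)) (2 * Real.pi / ω) :=
      fun t => by
        have := periodic_cos_mul hω t
        simp only at this ⊢
        rw [hYper t, this]
    obtain ⟨t₀, h0, hmax⟩ := hper.exists_isMax_hasDerivAt_eq_zero (two_pi_div_ne_zero hω)
      fun t => (hY t).add ((hasDerivAt_cos_mul ω t).const_mul (A / ω))
    have h1 : Y t₀ = 0 := by
      apply hΦanti.injective
      rw [hΦid 0 hm0 hM0, hf.map_zero]
      rw [hg] at h0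
      have h2 : A / ω * -(ω * Real.sin (ω * t₀)) = -(A * Real.sin (ω * t₀)) := by
        field_simp
      linarith
    intro t
    have h2 := hmax t
    simp only [h1] at h2
    have h3 := mul_le_mul_of_nonneg_left (Real.cos_le_one (ω * t₀)) (div_nonneg hA hω.le)
    have h4 := mul_le_mul_of_nonneg_left (Real.neg_one_le_cos (ω * t)) (div_nonneg hA hω.le)
    have h5 : M = A / ω + A / ω := by rw [hM]; ring
    linarith
  refine ⟨Y, fun t => hm1.trans_le (hlow t), fun t => ?_, hYper⟩
  have h := hY t
  rwa [hΦid _ (hlow t) (hupp t)] at h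

namespace IsPeriodicSolution

variable {y z : ℝ → ℝ}

theorem le_of_isPeriodicSolution (hf : IsCrackLaw f fmin) (hω : 0 < ω)
    (hy : IsPeriodicSolution f ω A y) (hz : IsPeriodicSolution f ω A z) (t : ℝ) : y t ≤ z t := by
  obtain ⟨t₀, h0, hmax⟩ := (hy.periodic.sub hz.periodic).exists_isMax_hasDerivAt_eq_zero
    (two_pi_div_ne_zero hω) fun t => (hy.hasDerivAt t).sub (hz.hasDerivAt t)
  have h1 : y t₀ = z t₀ :=
    hf.strictAntiOn.injOn (hy.mem_domain t₀) (hz.mem_domain t₀) (by linarith)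
  have h2 := hmax t
  simp only [Pi.sub_apply] at h2
  linarith

theorem eq_of_isPeriodicSolution (hf : IsCrackLaw f fmin) (hω : 0 < ω)
    (hy : IsPeriodicSolution f ω A y) (hz : IsPeriodicSolution f ω A z) : y = z :=
  funext fun t => (le_of_isPeriodicSolution hf hω hy hz t).antisymm
    (le_of_isPeriodicSolution hf hω hz hy t)

theorem crackLawInv_le (hf : IsCrackLaw f fmin) (hω : 0 < ω) (hA : 0 ≤ A)
    (hy : IsPeriodicSolution f ω A y) (t : ℝ) : crackLawInv f A ≤ y t := by
  obtain ⟨hm1, hfm, -⟩ := hf.crackLawInv_spec hA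
  obtain ⟨t₀, h0, hmin⟩ := hy.periodic.exists_isMin_hasDerivAt_eq_zero
    (two_pi_div_ne_zero hω) hy.hasDerivAt
  refine le_trans ?_ (hmin t)
  rw [← hf.strictAntiOn.le_iff_ge (hy.mem_domain t₀) hm1, hfm]
  have := mul_le_mul_of_nonneg_left (Real.neg_one_le_sin (ω * t₀)) hA
  linarith

end IsPeriodicSolution

/-! ### Comparison with the linear response -/

/-- The periodic solution of the linearised equation `y' = -y + A sin(ω t)`. -/
noncomputable def linearResponse (ω A t : ℝ) : ℝ :=
  A / (1 + ω ^ 2) * (Real.sin (ω * t) - ω * Real.cos (ω * t))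

theorem linearResponse_zero (ω A : ℝ) : linearResponse ω A 0 = -(A * ω / (1 + ω ^ 2)) := by
  simp [linearResponse]; ring

theorem periodic_linearResponse (hω : 0 < ω) (A : ℝ) :
    Function.Periodic (linearResponse ω A) (2 * Real.pi / ω) := fun t => by
  have h1 := periodic_sin_mul hω t
  have h2 := periodic_cos_mul hω t
  simp only at h1 h2
  simp only [linearResponse, h1, h2]

theorem hasDerivAt_linearResponse (ω A t : ℝ) :
    HasDerivAt (linearResponse ω A) (-linearResponse ω A t + A * Real.sin (ω * t)) t := by
  refine (((hasDerivAt_sin_mul ω t).sub ((hasDerivAt_cos_mul ω t).const_mul ω)).const_mul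
    (A / (1 + ω ^ 2))).congr_deriv ?_
  have : (1 + ω ^ 2) ≠ 0 := by positivity
  simp only [linearResponse]
  field_simp
  ring

namespace IsPeriodicSolution

variable {y z : ℝ → ℝ}

theorem linearResponse_le (hf : IsCrackLaw f fmin) (hω : 0 < ω)
    (hy : IsPeriodicSolution f ω A y) (t : ℝ) : linearResponse ω A t ≤ y t := by
  obtain ⟨t₀, h0, hmin⟩ :=
    (hy.periodic.sub (periodic_linearResponse hω A)).exists_isMin_hasDerivAt_eq_zero
      (two_pi_div_ne_zero hω) fun t => (hy.hasDerivAt t).sub (hasDerivAt_linearResponse ω A t)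
  have h1 := hmin t
  simp only [Pi.sub_apply] at h1
  have h2 := hf.neg_le (hy.mem_domain t₀)
  linarith

/-- At a maximum `f (y t₀) ≥ -A > f δ` keeps `y t₀` below `δ`; if `y t₀ ≥ 0`, the slope of `f` on
`[0, y t₀]` is at most `deriv f δ < 0`. -/
theorem abs_le_mul (hf : IsCrackLaw f fmin) (hω : 0 < ω) {δ : ℝ} (hδ : 0 < δ) (hA : 0 ≤ A)
    (hAδ : A < -f δ) (hy : IsPeriodicSolution f ω A y) (t : ℝ) :
    |y t| ≤ max 1 (-(deriv f δ))⁻¹ * A := by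
  have hk : 0 < -deriv f δ := neg_pos.2 (hf.deriv_neg δ (by linarith))
  have hle1 : A ≤ max 1 (-(deriv f δ))⁻¹ * A := le_mul_of_one_le_left hA (le_max_left _ _)
  refine abs_le.2 ⟨?_, ?_⟩
  · obtain ⟨t₀, h0, hmin⟩ := hy.periodic.exists_isMin_hasDerivAt_eq_zero
      (two_pi_div_ne_zero hω) hy.hasDerivAt
    have h1 := hf.neg_le (hy.mem_domain t₀)
    have h2 := mul_le_mul_of_nonneg_left (Real.neg_one_le_sin (ω * t₀)) hA
    linarith [hmin t]
  · obtain ⟨t₀, h0, hmax⟩ := hy.periodic.exists_isMax_hasDerivAt_eq_zero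
      (two_pi_div_ne_zero hω) hy.hasDerivAt
    refine (hmax t).trans ?_
    have h2 := mul_le_mul_of_nonneg_left (Real.sin_le_one (ω * t₀)) hA
    rcases le_total (y t₀) 0 with h3 | h3
    · linarith
    have h4 : y t₀ ≤ δ := by
      by_contra! h
      have := hf.strictAntiOn (mem_Ioi.2 (by linarith)) (hy.mem_domain t₀) h
      linarith
    have h5 := (hf.slope_bounds (m := 0) (by norm_num) le_rfl h3 h4).2
    rw [hf.map_zero] at h5
    have h6 : -deriv f δ * y t₀ ≤ A := by linarith
    calc y t₀ = (-deriv f δ)⁻¹ * (-deriv f δ * y t₀) :=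
          (inv_mul_cancel_left₀ hk.ne' _).symm
      _ ≤ (-deriv f δ)⁻¹ * A := mul_le_mul_of_nonneg_left h6 (inv_pos.2 hk).le
      _ ≤ _ := mul_le_mul_of_nonneg_right (le_max_right _ _) hA

/-- At a maximum of the difference the linear response equals `-f (y t₀)`, so the gap is `y t₀ + f
(y t₀)`, the quadratic remainder. -/
theorem sub_linearResponse_le (hω : 0 < ω) {C L : ℝ}
    (hy : IsPeriodicSolution f ω A y)
    (hC : ∀ t, f (y t) ≤ -y t + C * y t ^ 2) (hL : ∀ t, C * y t ^ 2 ≤ L) (t : ℝ) :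
    y t - linearResponse ω A t ≤ L := by
  obtain ⟨t₀, h0, hmax⟩ :=
    (hy.periodic.sub (periodic_linearResponse hω A)).exists_isMax_hasDerivAt_eq_zero
      (two_pi_div_ne_zero hω) fun t => (hy.hasDerivAt t).sub (hasDerivAt_linearResponse ω A t)
  have h1 := hmax t
  simp only [Pi.sub_apply] at h1
  linarith [hC t₀, hL t₀]

end IsPeriodicSolution
end PeriodicSolution

/-! ### One-sided Gronwall comparison -/

/-- A one-sided Gronwall principle: if `Z' ≥ K Z` wherever `Z < 0`, then `Z` cannot become
negative. -/
theorem nonneg_of_mul_le_deriv {Z Z' : ℝ → ℝ} {a b K : ℝ} (hZ : ∀ t, HasDerivAt Z (Z' t) t)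
    (ha : 0 ≤ Z a) (h : ∀ t ∈ Icc a b, Z t < 0 → K * Z t ≤ Z' t) : ∀ t ∈ Icc a b, 0 ≤ Z t := by
  intro t₁ ht₁
  by_contra! hneg
  have hc : Continuous Z := continuous_iff_continuousAt.2 fun t => (hZ t).continuousAt
  -- After the last time `t₀` with `Z ≥ 0`, the product `exp(-Kt) Z` is nondecreasing up to `t₁`, so
  -- it cannot turn negative.
  have hcomp : IsCompact {t ∈ Icc a t₁ | 0 ≤ Z t} :=
    isCompact_Icc.inter_right (isClosed_le continuous_const hc)
  obtain ⟨t₀, ⟨⟨hat₀, ht₀₁⟩, hZ₀⟩, hub⟩ := hcomp.exists_isGreatest ⟨a, ⟨le_rfl, ht₁.1⟩, ha⟩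
  have hE : ∀ t, HasDerivAt (fun t => Real.exp (-(K * t)) * Z t)
      (Real.exp (-(K * t)) * (Z' t - K * Z t)) t := fun t => by
    have h3 : HasDerivAt (fun u : ℝ => Real.exp (-(K * u))) (Real.exp (-(K * t)) * (-(K * 1))) t :=
      (((hasDerivAt_id t).const_mul K).neg).exp
    exact (h3.mul (hZ t)).congr_deriv (by ring)
  have hmono : MonotoneOn (fun t => Real.exp (-(K * t)) * Z t) (Icc t₀ t₁) := by
    refine monotoneOn_of_deriv_nonneg (convex_Icc _ _)
      (fun t _ => (hE t).continuousAt.continuousWithinAt)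
      (fun t _ => (hE t).differentiableAt.differentiableWithinAt) fun t ht => ?_
    rw [interior_Icc] at ht
    have hlt : Z t < 0 := by
      by_contra! h0
      exact absurd (hub ⟨⟨hat₀.trans ht.1.le, ht.2.le⟩, h0⟩) (not_le.2 ht.1)
    rw [(hE t).deriv]
    exact mul_nonneg (Real.exp_pos _).le
      (sub_nonneg.2 (h t ⟨hat₀.trans ht.1.le, ht.2.le.trans ht₁.2⟩ hlt))
  have h1 := hmono ⟨le_rfl, ht₀₁⟩ ⟨ht₀₁, le_rfl⟩ ht₀₁
  have h2 : 0 ≤ Real.exp (-(K * t₀)) * Z t₀ := mul_nonneg (Real.exp_pos _).le hZ₀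
  have h3 : Real.exp (-(K * t₁)) * Z t₁ < 0 := mul_neg_of_pos_of_neg (Real.exp_pos _) hneg
  exact absurd (h2.trans h1) (not_le.2 h3)

/-- The time-reversed version of `nonneg_of_mul_le_deriv`. -/
theorem nonneg_of_deriv_le_mul {Z Z' : ℝ → ℝ} {a b K : ℝ} (hZ : ∀ t, HasDerivAt Z (Z' t) t)
    (hb : 0 ≤ Z b) (h : ∀ t ∈ Icc a b, Z t < 0 → Z' t ≤ K * Z t) : ∀ t ∈ Icc a b, 0 ≤ Z t := by
  intro t ht
  have h1 : ∀ t, HasDerivAt (fun t => Z (-t)) (-Z' (-t)) t := fun t =>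
    ((hZ (-t)).comp t (hasDerivAt_neg t)).congr_deriv (by ring)
  have h2 := nonneg_of_mul_le_deriv (a := -b) (b := -a) (K := -K) h1 (by simpa using hb)
    (fun s hs hneg => by
      have := h (-s) ⟨by linarith [hs.2], by linarith [hs.1]⟩ hneg
      linarith) (-t) ⟨by linarith [ht.2], by linarith [ht.1]⟩
  simpa using h2

/-! ### Monotonicity, convexity and expansion of the initial value -/

section PeriodicSolution

variable {f : ℝ → ℝ} {fmin : EReal} {ω A B : ℝ}

namespace IsPeriodicSolution

variable {x y z : ℝ → ℝ}

/-- If the initial value did not decrease with the amplitude of the forcing, the solutions would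
be ordered at all times. -/
theorem le_of_le_at_zero (hf : IsCrackLaw f fmin) (hω : 0 < ω) (hA : 0 ≤ A) (hAB : A ≤ B)
    (hy : IsPeriodicSolution f ω A y) (hz : IsPeriodicSolution f ω B z) (h0 : y 0 ≤ z 0) (t : ℝ) :
    y t ≤ z t := by
  set T := 2 * Real.pi / ω with hT
  have hT0 : 0 < T := by positivity
  have hωT : ω * T = 2 * Real.pi := mul_div_cancel₀ _ hω.ne'
  set m := crackLawInv f B
  have hm1 : -1 < m := (hf.crackLawInv_spec (hA.trans hAB)).1
  have hd : ∀ t, HasDerivAt (fun t => z t - y t)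
      (f (z t) + B * Real.sin (ω * t) - (f (y t) + A * Real.sin (ω * t))) t := fun t =>
    (hz.hasDerivAt t).sub (hy.hasDerivAt t)
  have hfirst : ∀ t ∈ Icc 0 (T / 2), 0 ≤ z t - y t := by
    refine nonneg_of_mul_le_deriv (K := 0) hd (by linarith) fun t ht hneg => ?_
    have hs : 0 ≤ Real.sin (ω * t) := by
      have := mul_le_mul_of_nonneg_left ht.2 hω.le
      exact Real.sin_nonneg_of_nonneg_of_le_pi (mul_nonneg hω.le ht.1) (by linarith)
    have h1 := hf.strictAntiOn (hz.mem_domain t) (hy.mem_domain t) (sub_neg.1 hneg)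
    have h2 := mul_nonneg (sub_nonneg.2 hAB) hs
    linarith
  have hsecond : ∀ t ∈ Icc (T / 2) T, 0 ≤ z t - y t := by
    refine nonneg_of_deriv_le_mul (K := deriv f m) hd ?_ fun t ht hneg => ?_
    · have h1 := hy.periodic 0
      have h2 := hz.periodic 0
      rw [zero_add] at h1 h2
      rw [h1, h2]
      linarith
    have hs : Real.sin (ω * t) ≤ 0 := by
      have h1 := mul_le_mul_of_nonneg_left ht.1 hω.le
      have h2 := mul_le_mul_of_nonneg_left ht.2 hω.le
      have h3 := Real.sin_nonneg_of_nonneg_of_le_pi (x := ω * t - Real.pi)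
        (by linarith) (by linarith)
      rw [Real.sin_sub_pi] at h3
      linarith
    have h1 := (hf.slope_bounds hm1 (crackLawInv_le hf hω (hA.trans hAB) hz t)
      (sub_neg.1 hneg).le le_rfl).1
    have h2 := mul_nonneg_of_nonpos_of_nonpos (sub_nonpos.2 hAB) hs
    linarith
  obtain ⟨s, hs, hst⟩ := (hz.periodic.sub hy.periodic).exists_mem_Ico₀ hT0 t
  simp only [Pi.sub_apply] at hst
  rw [← sub_nonneg, hst]
  rcases le_total s (T / 2) with h | h
  · exact hfirst s ⟨hs.1, h⟩
  · exact hsecond s ⟨h, hs.2.le⟩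

theorem initial_lt (hf : IsCrackLaw f fmin) (hω : 0 < ω) (hA : 0 ≤ A) (hAB : A < B)
    (hy : IsPeriodicSolution f ω A y) (hz : IsPeriodicSolution f ω B z) : z 0 < y 0 := by
  by_contra! h0
  have hle := le_of_le_at_zero hf hω hA hAB.le hy hz h0
  -- The cosine cancels the forcing, so `G' = f(z) - f(y) ≤ 0`; a periodic antitone function is
  -- constant, whence `f(z) = f(y)`.
  set G : ℝ → ℝ := fun t => z t - y t + (B - A) / ω * Real.cos (ω * t) with hG
  have hGd : ∀ t, HasDerivAt G (f (z t) - f (y t)) t := fun t => by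
    refine (((hz.hasDerivAt t).sub (hy.hasDerivAt t)).add
      ((hasDerivAt_cos_mul ω t).const_mul ((B - A) / ω))).congr_deriv ?_
    have : (B - A) / ω * -(ω * Real.sin (ω * t)) = -((B - A) * Real.sin (ω * t)) := by
      field_simp
    linarith
  have hGper : Function.Periodic G (2 * Real.pi / ω) := fun t => by
    have := periodic_cos_mul hω t
    simp only at this
    simp only [hG, hz.periodic t, hy.periodic t, this]
  have hGanti : Antitone G := antitone_of_hasDerivAt_nonpos hGd fun t =>
    sub_nonpos.2 (hf.strictAntiOn.antitoneOn (hy.mem_domain t) (hz.mem_domain t) (hle t))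
  have hGle : ∀ s t, G s ≤ G t := fun s t => by
    obtain ⟨r, hr, hrt⟩ := hGper.exists_mem_Ico (by positivity : 0 < 2 * Real.pi / ω) t
      (s - 2 * Real.pi / ω)
    rw [hrt]
    exact hGanti (by linarith [hr.2])
  have hzero : ∀ t, f (z t) - f (y t) = 0 := fun t =>
    IsLocalMax.hasDerivAt_eq_zero (Eventually.of_forall fun s => hGle s t) (hGd t)
  have hzy : z = y := funext fun t =>
    hf.strictAntiOn.injOn (hz.mem_domain t) (hy.mem_domain t) (sub_eq_zero.1 (hzero t))
  have h1 := (hz.hasDerivAt (Real.pi / 2 / ω)).unique (hzy ▸ hy.hasDerivAt (Real.pi / 2 / ω))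
  rw [hzy, mul_div_cancel₀ _ hω.ne', Real.sin_pi_div_two] at h1
  linarith

/-- Strict convexity of the initial value in the amplitude. -/
theorem initial_lt_convex_comb (hf : IsCrackLaw f fmin) (hω : 0 < ω) {a b : ℝ} (ha : 0 < a)
    (hb : 0 < b) (hab : a + b = 1)
    (hx : IsPeriodicSolution f ω (a * A + b * B) x)
    (hy : IsPeriodicSolution f ω A y) (hz : IsPeriodicSolution f ω B z) (hne : y 0 ≠ z 0) :
    x 0 < a * y 0 + b * z 0 := by
  have hd : ∀ t, HasDerivAt (fun t => a * y t + b * z t - x t)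
      (a * f (y t) + b * f (z t) - f (x t)) t := fun t =>
    ((((hy.hasDerivAt t).const_mul a).add ((hz.hasDerivAt t).const_mul b)).sub
      (hx.hasDerivAt t)).congr_deriv (by ring)
  have hper : Function.Periodic (fun t => a * y t + b * z t - x t) (2 * Real.pi / ω) :=
    fun t => by simp only [hy.periodic t, hz.periodic t, hx.periodic t]
  have hmem : ∀ t, a * y t + b * z t ∈ Ioi (-1 : ℝ) := fun t =>
    convex_Ioi (-1 : ℝ) (hy.mem_domain t) (hz.mem_domain t) ha.le hb.le hab
  obtain ⟨t₀, h0, hmin⟩ := hper.exists_isMin_hasDerivAt_eq_zero (two_pi_div_ne_zero hω) hd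
  have hpos : ∀ t, 0 ≤ a * y t + b * z t - x t := by
    have h1 := hf.strictConvexOn.convexOn.2 (hy.mem_domain t₀) (hz.mem_domain t₀) ha.le hb.le hab
    simp only [smul_eq_mul] at h1
    have h2 : x t₀ ≤ a * y t₀ + b * z t₀ := by
      rw [← hf.strictAntiOn.le_iff_ge (hmem t₀) (hx.mem_domain t₀)]
      linarith
    exact fun t => (sub_nonneg.2 h2).trans (hmin t)
  -- Equality would make 0 a minimum of the gap; its vanishing derivative contradicts strict
  -- convexity of `f`, as `y 0 ≠ z 0`.
  refine lt_of_le_of_ne (sub_nonneg.1 (hpos 0)) fun heq => ?_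
  have h1 : a * f (y 0) + b * f (z 0) - f (x 0) = 0 :=
    IsLocalMin.hasDerivAt_eq_zero (f := fun t => a * y t + b * z t - x t)
      (Eventually.of_forall fun t => by
        have := hpos t
        simp only
        linarith) (hd 0)
  have h2 := hf.strictConvexOn.2 (hy.mem_domain 0) (hz.mem_domain 0) hne ha hb hab
  simp only [smul_eq_mul] at h2
  rw [← heq] at h2
  linarith

theorem initial_expansion (hf : IsCrackLaw f fmin) (hω : 0 < ω) {Y : ℝ → ℝ → ℝ}
    (hY : ∀ A, 0 ≤ A → IsPeriodicSolution f ω A (Y A)) :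
    (fun A => Y A 0 - (-(A * ω / (1 + ω ^ 2)))) =O[𝓝[≥] 0] (fun A => A ^ 2) := by
  obtain ⟨C, δ, hC, hδ, hδ1, hquad⟩ := hf.exists_le_neg_add_sq
  set L := max 1 (-(deriv f δ))⁻¹ with hL
  have hL1 : 1 ≤ L := le_max_left _ _
  have hfδ : 0 < -f δ := by
    have := hf.strictAntiOn (a := 0) (by simp) (mem_Ioi.2 (by linarith)) hδ
    rw [hf.map_zero] at this
    linarith
  refine IsBigO.of_bound (C * L ^ 2) ?_
  have hev : ∀ᶠ A in 𝓝[≥] (0 : ℝ), A < min (-f δ) (δ / L) :=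
    mem_nhdsWithin_of_mem_nhds (Iio_mem_nhds (lt_min hfδ (by positivity)))
  filter_upwards [hev, self_mem_nhdsWithin] with A hAlt hA
  have hA : 0 ≤ A := hA
  have habs := abs_le_mul hf hω hδ hA (hAlt.trans_le (min_le_left _ _)) (hY A hA)
  rw [← hL] at habs
  have hLA : L * A ≤ δ := by
    have := (hAlt.trans_le (min_le_right _ _)).le
    rw [le_div_iff₀ (by positivity)] at this
    linarith
  have h1 := sub_linearResponse_le hω (hY A hA) (fun t => hquad _ ((habs t).trans hLA))
    (L := C * (L * A) ^ 2)
    (fun t => mul_le_mul_of_nonneg_left (sq_le_sq' (abs_le.1 (habs t)).1 (abs_le.1 (habs t)).2) hC)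
    0
  have h2 := linearResponse_le hf hω (hY A hA) 0
  rw [linearResponse_zero] at h1 h2
  rw [Real.norm_of_nonneg (by linarith), Real.norm_of_nonneg (sq_nonneg A)]
  linarith

end IsPeriodicSolution

theorem isPeriodicSolution_zero (hf : IsCrackLaw f fmin) (ω : ℝ) :
    IsPeriodicSolution f ω 0 fun _ => 0 where
  mem_domain _ := by norm_num
  hasDerivAt t := by simpa [hf.map_zero] using hasDerivAt_const t (0 : ℝ)
  periodic _ := rfl

end PeriodicSolution

theorem proposition5p1 (f : ℝ → ℝ) (fmin : EReal) (hf : IsCrackLaw f fmin)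
    (ω : ℝ) (hω : 0 < ω) :
    ∃ Y : ℝ → ℝ → ℝ,
      -- for every `A ≥ 0`, `Y A` is the unique periodic solution
      (∀ A : ℝ, 0 ≤ A → ∀ y : ℝ → ℝ, IsPeriodicSolution f ω A y ↔ y = Y A) ∧
      -- properties of the initial value `A ↦ Y A 0`
      StrictAntiOn (fun A => Y A 0) (Ici 0) ∧
      StrictConvexOn ℝ (Ici 0) (fun A => Y A 0) ∧
      (∀ A : ℝ, 0 ≤ A →
        -1 < max (crackLawInv f A) (-(A * ω / (1 + ω ^ 2))) ∧
        max (crackLawInv f A) (-(A * ω / (1 + ω ^ 2))) ≤ Y A 0 ∧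
        Y A 0 ≤ 0 ∧
        (Y A 0 = 0 ↔ A = 0)) ∧
      (fun A => Y A 0 - (-(A * ω / (1 + ω ^ 2)))) =O[𝓝[≥] 0] (fun A => A ^ 2) := by
  have hex : ∀ A : ℝ, 0 ≤ A → ∃ y, IsPeriodicSolution f ω A y := fun A hA =>
    hf.exists_isPeriodicSolution hω hA
  choose! Y hY using hex
  have hanti : StrictAntiOn (fun A => Y A 0) (Ici 0) := fun A hA B hB hAB =>
    IsPeriodicSolution.initial_lt hf hω hA hAB (hY A hA) (hY B hB)
  have hY0 : Y 0 0 = 0 := congr_fun (IsPeriodicSolution.eq_of_isPeriodicSolution hf hω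
    (hY 0 le_rfl) (isPeriodicSolution_zero hf ω)) 0
  refine ⟨Y, fun A hA y => ⟨fun hy =>
    IsPeriodicSolution.eq_of_isPeriodicSolution hf hω hy (hY A hA), fun h => h ▸ hY A hA⟩,
    hanti, ⟨convex_Ici 0, ?_⟩, fun A hA => ⟨?_, ?_, ?_, ?_, ?_⟩,
    IsPeriodicSolution.initial_expansion hf hω hY⟩
  · intro A hA B hB hAB a b ha hb hab
    exact IsPeriodicSolution.initial_lt_convex_comb hf hω ha hb hab
      (hY _ (convex_Ici 0 hA hB ha.le hb.le hab)) (hY A hA) (hY B hB)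
      fun h => hAB (hanti.injOn hA hB h)
  · exact (hf.crackLawInv_spec hA).1.trans_le (le_max_left _ _)
  · refine max_le (IsPeriodicSolution.crackLawInv_le hf hω hA (hY A hA) 0) ?_
    rw [← linearResponse_zero]
    exact IsPeriodicSolution.linearResponse_le hf hω (hY A hA) 0
  · exact (hanti.antitoneOn (mem_Ici.2 le_rfl) hA hA).trans_eq hY0
  · intro h
    exact hanti.injOn hA (mem_Ici.2 le_rfl) (h.trans hY0.symm)
  · rintro rfl
    exact hY0
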